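/- **Theorem 2.** Call a sequence $\{a_k\}_{k=1}^\infty$ of nonnegative real numbers *admissible* if $$a_{2j-1}\ \ge\ \frac{2j}{2j-1}\,a_{2j}\qquad\text{and}\qquad a_{2j}\ \ge\ \frac{(2j+1)(4j-1)}{2j(4j+3)}\,a_{2j+1}\qquad\text{for all } j=1,2,\dots$$ If $\{a_k\}$ is admissible, then all partial sums of $\sum a_k\sin(kx)$ are nonnegative on $[0,\pi]$, that is, $$\sum_{k=1}^{n} a_k\sin(kx)\ \ge\ 0\qquad\text{for all } x\in[0,\pi] \text{ and all } n=1,2,3,\dots$$ For real sequences write $\{a_k\}\succeq\{b_k\}$ if $a_k=0$ implies $b_k=0$ and, after skipping the indices with $a_k=0$, the quotients $b_k/a_k$ are nonnegative and non-increasing in $k$. Then the sequence $$\delta_k = 2-\frac{(-1)^k}{k}\qquad(k\ge 1)$$ is maximal among the admissible sequences: it is admissible, and $\{\delta_k\}\succeq\{b_k\}$ for every admissible sequence $\{b_k\}$. It is the only sequence with these two properties, up to multiplication by a positive constant. -/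

import Mathlib

namespace SineSums

/-! Sequences `a₁, a₂, a₃, …` are functions `ℕ → ℝ` of which only the values at `k ≥ 1` matter. -/

/-- The `n`-th partial sum `∑_{k=1}^n a_k sin(kx)`. -/
noncomputable def partialSum (a : ℕ → ℝ) (n : ℕ) (x : ℝ) : ℝ :=
  ∑ k ∈ Finset.Icc 1 n, a k * Real.sin (k * x)

/-- `∑ a_k sin(kx)` is a P-sum in `I`: all its partial sums are nonnegative on `I`. -/
def IsPSum (a : ℕ → ℝ) (I : Set ℝ) : Prop :=
  ∀ n : ℕ, 1 ≤ n → ∀ x ∈ I, 0 ≤ partialSum a n x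

/-- A sequence of nonnegative numbers with Vietoris' condition on the pairs `(2j-1, 2j)` and the
second condition on the pairs `(2j, 2j+1)`. -/
structure Admissible (a : ℕ → ℝ) : Prop where
  nonneg : ∀ k : ℕ, 1 ≤ k → 0 ≤ a k
  vietoris : ∀ j : ℕ, 1 ≤ j → (2 * j : ℝ) / (2 * j - 1) * a (2 * j) ≤ a (2 * j - 1)
  even_odd : ∀ j : ℕ, 1 ≤ j →
    ((2 * j + 1) * (4 * j - 1) : ℝ) / (2 * j * (4 * j + 3)) * a (2 * j + 1) ≤ a (2 * j)

/-- The comparison order `a ⪰ b`: `a_k = 0` implies `b_k = 0`, and, after skipping the indices with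
`a_k = 0`, the quotients `b_k / a_k` are nonnegative and non-increasing. -/
structure Dominates (a b : ℕ → ℝ) : Prop where
  zero_of_zero : ∀ k : ℕ, 1 ≤ k → a k = 0 → b k = 0
  ratio_nonneg : ∀ k : ℕ, 1 ≤ k → a k ≠ 0 → 0 ≤ b k / a k
  ratio_antitone : ∀ k l : ℕ, 1 ≤ k → k ≤ l → a k ≠ 0 → a l ≠ 0 → b l / a l ≤ b k / a k

/-- `a` is maximal among the admissible sequences: it is admissible and dominates each of them. -/
def IsMaximalAdmissible (a : ℕ → ℝ) : Prop :=
  Admissible a ∧ ∀ b : ℕ → ℝ, Admissible b → Dominates a b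

/-- The coefficients `δ_k = 2 - (-1)^k / k`, that is `3, 3/2, 7/3, 7/4, 11/5, 11/6, …`. -/
noncomputable def delta (k : ℕ) : ℝ := 2 - (-1) ^ k / k

end SineSums

namespace SineSums

open Real Finset

/-! ### The sequence `delta` and the comparison order -/

/-! Both admissibility inequalities are equalities for `delta`, so an admissible `a` has
non-increasing quotients `a k / delta k`. This gives maximality, and summation by parts reduces
nonnegativity to `delta` itself. At `x = π - 2h` the sum for `delta`, times `cos h`, equals `cos h *
F + sin h - (-1)^n sin (M h)`, with `F` the Fejér–Jackson sum and `M = 2n + 1`. If `M h ≤ π`, every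
term of `F` is nonnegative, which settles odd `n`; even `n` follows by monotonicity in `h`. If `M h
≥ π`, a lower bound for `F` from integrating `F' = sin (M h) / sin h - 1` down from `π/2` suffices
for both signs. -/

lemma delta_odd (j : ℕ) : delta (2 * j + 1) = (4 * j + 3) / (2 * j + 1) := by
  have h : (2 * j + 1 : ℝ) ≠ 0 := by positivity
  rw [delta, pow_succ, pow_mul]
  push_cast
  field_simp
  norm_num
  ring

lemma delta_even (j : ℕ) : delta (2 * j + 2) = (4 * j + 3) / (2 * j + 2) := by
  have h : (2 * j + 2 : ℝ) ≠ 0 := by positivity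
  rw [delta, show 2 * j + 2 = 2 * (j + 1) by ring, pow_mul]
  push_cast
  field_simp
  norm_num
  ring

lemma delta_pos {k : ℕ} (hk : 1 ≤ k) : 0 < delta k := by
  obtain ⟨j, rfl | rfl⟩ : ∃ j, k = 2 * j + 1 ∨ k = 2 * j + 2 := ⟨(k - 1) / 2, by omega⟩
  · rw [delta_odd]; positivity
  · rw [delta_even]; positivity

lemma admissible_delta : Admissible delta where
  nonneg k hk := (delta_pos hk).le
  vietoris j hj := by
    obtain ⟨i, rfl⟩ := Nat.exists_eq_add_of_le' hj
    rw [show 2 * (i + 1) - 1 = 2 * i + 1 by omega, show 2 * (i + 1) = 2 * i + 2 by ring,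
      delta_odd, delta_even]
    apply le_of_eq
    push_cast
    have h1 : (2 * (i + 1) - 1 : ℝ) = 2 * i + 1 := by ring
    rw [h1]
    field_simp
  even_odd j hj := by
    obtain ⟨i, rfl⟩ := Nat.exists_eq_add_of_le' hj
    rw [delta_odd, show 2 * (i + 1) = 2 * i + 2 by ring, delta_even]
    apply le_of_eq
    push_cast
    field_simp
    ring

/-- The quotients of an admissible sequence by `delta` decrease from each index to the next. -/
lemma Admissible.ratio_succ_le {a : ℕ → ℝ} (ha : Admissible a) {k : ℕ} (hk : 1 ≤ k) :
    a (k + 1) / delta (k + 1) ≤ a k / delta k := by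
  rw [div_le_div_iff₀ (delta_pos (by omega)) (delta_pos hk)]
  obtain ⟨j, rfl | rfl⟩ : ∃ j, k = 2 * j + 1 ∨ k = 2 * j + 2 := ⟨(k - 1) / 2, by omega⟩
  · have h := ha.vietoris (j + 1) (by omega)
    rw [show 2 * (j + 1) - 1 = 2 * j + 1 by omega, show 2 * (j + 1) = 2 * j + 2 by ring] at h
    push_cast at h
    rw [show (2 * ((j : ℝ) + 1) - 1) = 2 * j + 1 by ring] at h
    rw [show 2 * j + 1 + 1 = 2 * j + 2 by ring, delta_odd, delta_even]
    have h2 := mul_le_mul_of_nonneg_right h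
      (show (0 : ℝ) ≤ (4 * j + 3) / (2 * j + 2) by positivity)
    refine le_trans (le_of_eq ?_) h2
    field_simp
  · have h := ha.even_odd (j + 1) (by omega)
    rw [show 2 * (j + 1) + 1 = 2 * j + 2 + 1 by ring, show 2 * (j + 1) = 2 * j + 2 by ring] at h
    push_cast at h
    rw [show 4 * ((j : ℝ) + 1) - 1 = 4 * j + 3 by ring] at h
    rw [delta_even, show delta (2 * j + 2 + 1) = delta (2 * (j + 1) + 1) by ring_nf, delta_odd]
    push_cast
    have h2 := mul_le_mul_of_nonneg_right h
      (show (0 : ℝ) ≤ (4 * (j + 1) + 3) / (2 * (j + 1) + 1) by positivity)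
    refine le_trans (le_of_eq ?_) h2
    field_simp

lemma Admissible.ratio_antitone {a : ℕ → ℝ} (ha : Admissible a) {k l : ℕ} (hk : 1 ≤ k)
    (hkl : k ≤ l) : a l / delta l ≤ a k / delta k := by
  induction l, hkl using Nat.le_induction with
  | base => exact le_rfl
  | succ l hl ih => exact (ha.ratio_succ_le (hk.trans hl)).trans ih

lemma isMaximalAdmissible_delta : IsMaximalAdmissible delta :=
  ⟨admissible_delta, fun _ hb =>
    { zero_of_zero := fun _ hk h => absurd h (delta_pos hk).ne'
      ratio_nonneg := fun k hk _ => div_nonneg (hb.nonneg k hk) (delta_pos hk).le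
      ratio_antitone := fun _ _ hk hkl _ _ => hb.ratio_antitone hk hkl }⟩

lemma IsMaximalAdmissible.eq_const_mul_delta {e : ℕ → ℝ} (he : IsMaximalAdmissible e) :
    ∃ c : ℝ, 0 < c ∧ ∀ k : ℕ, 1 ≤ k → e k = c * delta k := by
  have hpos : ∀ k, 1 ≤ k → 0 < e k := fun k hk =>
    lt_of_le_of_ne (he.1.nonneg k hk) fun h =>
      (delta_pos hk).ne' ((he.2 _ admissible_delta).zero_of_zero k hk h.symm)
  refine ⟨e 1 / delta 1, div_pos (hpos 1 le_rfl) (delta_pos le_rfl), fun k hk => ?_⟩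
  -- Each of `e` and `delta` dominates the other, so `e k / delta k` is both non-increasing and
  -- non-decreasing.
  have h1 := he.1.ratio_antitone le_rfl hk
  have h2 := (he.2 _ admissible_delta).ratio_antitone 1 k le_rfl hk (hpos 1 le_rfl).ne'
    (hpos k hk).ne'
  have hd := delta_pos hk
  have hd1 := delta_pos (le_refl 1)
  rw [div_le_div_iff₀ hd hd1] at h1
  rw [div_le_div_iff₀ (hpos k hk) (hpos 1 le_rfl)] at h2
  field_simp
  linarith

/-! ### Summation by parts -/

lemma partialSum_succ (a : ℕ → ℝ) (n : ℕ) (x : ℝ) :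
    partialSum a (n + 1) x = partialSum a n x + a (n + 1) * sin ((n + 1) * x) := by
  rw [partialSum, sum_Icc_succ_top (by omega)]
  push_cast
  rfl

lemma ratio_mul_partialSum_le {a d : ℕ → ℝ} {x : ℝ} (hd : ∀ k, 1 ≤ k → 0 < d k)
    (hr : ∀ k, 1 ≤ k → a (k + 1) / d (k + 1) ≤ a k / d k)
    (hS : ∀ n, 1 ≤ n → 0 ≤ partialSum d n x) {n : ℕ} (hn : 1 ≤ n) :
    a n / d n * partialSum d n x ≤ partialSum a n x := by
  induction n, hn using Nat.le_induction with
  | base =>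
    have := (hd 1 le_rfl).ne'
    simp only [partialSum, Icc_self, sum_singleton]
    apply le_of_eq
    field_simp
  | succ n hn ih =>
    have h := mul_le_mul_of_nonneg_right (hr n hn) (hS n hn)
    have h1 : a (n + 1) / d (n + 1) * d (n + 1) = a (n + 1) :=
      div_mul_cancel₀ _ (hd (n + 1) (by omega)).ne'
    rw [partialSum_succ, partialSum_succ, mul_add, ← mul_assoc, h1]
    linarith

/-! ### Trigonometric identities -/

/-- The Fejér–Jackson sum `∑_{k=1}^n sin(ky)/k` at `y = 2h`. -/
noncomputable def fejerJackson (n : ℕ) (h : ℝ) : ℝ :=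
  ∑ k ∈ Icc 1 n, sin (2 * k * h) / k

lemma fejerJackson_succ (n : ℕ) (h : ℝ) :
    fejerJackson (n + 1) h = fejerJackson n h + sin (2 * (n + 1) * h) / (n + 1) := by
  rw [fejerJackson, sum_Icc_succ_top (by omega)]
  push_cast
  rfl

lemma sin_nat_mul_pi_sub (k : ℕ) (y : ℝ) : sin (k * (π - y)) = -(-1) ^ k * sin (k * y) := by
  rw [mul_sub, sin_sub, sin_nat_mul_pi, cos_nat_mul_pi]
  ring

/-- The part `1/k` of `delta` yields the Fejér–Jackson sum; the part `2` yields an alternating sine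
sum that telescopes after multiplication by `cos h`. -/
lemma cos_mul_partialSum_delta (n : ℕ) (h : ℝ) :
    cos h * partialSum delta n (π - 2 * h) =
      cos h * fejerJackson n h + sin h - (-1) ^ n * sin ((2 * n + 1) * h) := by
  induction n with
  | zero => simp [partialSum, fejerJackson]
  | succ n ih =>
    have hk := sin_nat_mul_pi_sub (n + 1) (2 * h)
    push_cast at hk
    rw [partialSum_succ, fejerJackson_succ, mul_add, ih, hk, delta]
    push_cast
    rw [show ((n : ℝ) + 1) * (2 * h) = 2 * (n + 1) * h by ring,
      show (2 * (n : ℝ) + 1) * h = 2 * (n + 1) * h - h by ring,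
      show (2 * ((n : ℝ) + 1) + 1) * h = 2 * (n + 1) * h + h by ring, sin_sub, sin_add]
    have h1 : ((-1 : ℝ) ^ n) ^ 2 = 1 := by rw [← pow_mul, mul_comm, pow_mul]; simp
    have h2 : (n : ℝ) + 1 ≠ 0 := by positivity
    generalize sin (2 * ((n : ℝ) + 1) * h) = t
    rw [pow_succ]
    field_simp
    linear_combination cos h * t * h1

lemma sin_mul_sum_cos (n : ℕ) (h : ℝ) :
    sin h * ∑ k ∈ Icc 1 n, 2 * cos (2 * k * h) = sin ((2 * n + 1) * h) - sin h := by
  induction n with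
  | zero => simp
  | succ n ih =>
    rw [sum_Icc_succ_top (by omega), mul_add, ih]
    push_cast
    rw [show (2 * (n : ℝ) + 1) * h = 2 * (n + 1) * h - h by ring,
      show (2 * ((n : ℝ) + 1) + 1) * h = 2 * (n + 1) * h + h by ring, sin_sub, sin_add]
    ring

lemma hasDerivAt_fejerJackson (n : ℕ) {h : ℝ} (hh : sin h ≠ 0) :
    HasDerivAt (fejerJackson n) (sin ((2 * n + 1) * h) / sin h - 1) h := by
  have h1 : HasDerivAt (fejerJackson n) (∑ k ∈ Icc 1 n, 2 * cos (2 * k * h)) h := by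
    unfold fejerJackson
    refine HasDerivAt.fun_sum fun k hk => ?_
    have hk0 : (k : ℝ) ≠ 0 := by
      have := (mem_Icc.1 hk).1
      positivity
    have h2 := (((hasDerivAt_id h).const_mul (2 * (k : ℝ))).sin).div_const (k : ℝ)
    refine h2.congr_deriv ?_
    simp only [id]
    field_simp
  refine h1.congr_deriv ?_
  rw [eq_sub_iff_add_eq, eq_div_iff hh]
  linarith [sin_mul_sum_cos n h]

@[fun_prop]
lemma continuous_fejerJackson (n : ℕ) : Continuous (fejerJackson n) := by
  unfold fejerJackson
  fun_prop

lemma hasDerivAt_sin_const_mul (M h : ℝ) : HasDerivAt (fun x => sin (M * x)) (M * cos (M * h)) h := by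
  simpa [mul_comm] using ((hasDerivAt_id h).const_mul M).sin

lemma hasDerivAt_cos_const_mul (M h : ℝ) :
    HasDerivAt (fun x => cos (M * x)) (-(M * sin (M * h))) h := by
  simpa [mul_comm] using ((hasDerivAt_id h).const_mul M).cos

/-! ### The range `(2n+1)h ≤ π` -/

lemma fejerJackson_nonneg_of_le {n : ℕ} {h : ℝ} (h0 : 0 ≤ h) (hπ : (2 * n + 1) * h ≤ π) :
    0 ≤ fejerJackson n h := by
  refine sum_nonneg fun k hk => div_nonneg (sin_nonneg_of_nonneg_of_le_pi (by positivity) ?_)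
    k.cast_nonneg
  have : (k : ℝ) ≤ n := by exact_mod_cast (mem_Icc.1 hk).2
  nlinarith

/-- The difference of the two sides vanishes at `0` and has derivative `(M²/2 - 2) sin (M h) sin
(2h) ≥ 0`. -/
lemma half_mul_cos_mul_sin_le {M h : ℝ} (hM : 2 ≤ M) (h0 : 0 ≤ h) (hπ : M * h ≤ π) :
    M / 2 * cos (M * h) * sin (2 * h) ≤ sin (M * h) * cos (2 * h) := by
  let φ : ℝ → ℝ := fun h => sin (M * h) * cos (2 * h) - M / 2 * (cos (M * h) * sin (2 * h))
  have hd : ∀ x, HasDerivAt φ ((M ^ 2 / 2 - 2) * (sin (M * x) * sin (2 * x))) x := fun x => by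
    refine (((hasDerivAt_sin_const_mul M x).mul (hasDerivAt_cos_const_mul 2 x)).sub
      (((hasDerivAt_cos_const_mul M x).mul
        (hasDerivAt_sin_const_mul 2 x)).const_mul (M / 2))).congr_deriv ?_
    ring
  have hm : MonotoneOn φ (Set.Icc 0 h) := by
    refine monotoneOn_of_deriv_nonneg (convex_Icc _ _)
      (fun x _ => (hd x).continuousAt.continuousWithinAt)
      (fun x _ => (hd x).differentiableAt.differentiableWithinAt) fun x hx => ?_
    rw [interior_Icc] at hx
    obtain ⟨hx0, hxh⟩ := hx
    rw [(hd x).deriv]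
    have hMx : M * x ≤ π := by nlinarith
    refine mul_nonneg (by nlinarith) (mul_nonneg ?_ ?_)
    · exact sin_nonneg_of_nonneg_of_le_pi (by positivity) hMx
    · exact sin_nonneg_of_nonneg_of_le_pi (by positivity) (by nlinarith)
  have := hm (Set.left_mem_Icc.2 h0) (Set.right_mem_Icc.2 h0) h0
  simp only [φ, mul_zero, sin_zero, zero_mul, sub_zero] at this
  linarith

lemma sin_le_cos_mul_fejerJackson_add {n : ℕ} (hn : 1 ≤ n) {h : ℝ} (h0 : 0 ≤ h)
    (hπ : (2 * n + 1) * h ≤ π) :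
    sin ((2 * n + 1) * h) ≤ cos h * fejerJackson n h + sin h := by
  have hn' : (1 : ℝ) ≤ n := by exact_mod_cast hn
  have hpi := pi_pos
  set M : ℝ := 2 * n + 1 with hM
  let G : ℝ → ℝ := fun x => fejerJackson n x + (sin x - sin (M * x)) / cos x
  have hlt : ∀ x, 0 ≤ x → x ≤ h → x < π / 2 := fun x hx0 hxh => by nlinarith
  have hcos : ∀ x, 0 ≤ x → x ≤ h → 0 < cos x := fun x hx0 hxh =>
    cos_pos_of_mem_Ioo ⟨by linarith, hlt x hx0 hxh⟩
  have hd : ∀ x, 0 < x → x ≤ h → HasDerivAt G (sin (M * x) / sin x - 1 +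
      ((cos x - M * cos (M * x)) * cos x - (sin x - sin (M * x)) * (-sin x)) / cos x ^ 2) x :=
    fun x hx0 hxh => (hasDerivAt_fejerJackson n
      (sin_pos_of_pos_of_lt_pi hx0 (by linarith [hlt x hx0.le hxh])).ne').add
      (((hasDerivAt_sin x).sub (hasDerivAt_sin_const_mul M x)).div (hasDerivAt_cos x)
        (hcos x hx0.le hxh).ne')
  have hm : MonotoneOn G (Set.Icc 0 h) := by
    refine monotoneOn_of_deriv_nonneg (convex_Icc _ _) ?_ ?_ ?_
    · refine (continuous_fejerJackson n).continuousOn.add (ContinuousOn.div (by fun_prop)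
        (by fun_prop) fun x hx => (hcos x hx.1 hx.2).ne')
    · intro x hx
      rw [interior_Icc] at hx
      exact (hd x hx.1 hx.2.le).differentiableAt.differentiableWithinAt
    · intro x hx
      rw [interior_Icc] at hx
      rw [(hd x hx.1 hx.2.le).deriv]
      have hc := hcos x hx.1.le hx.2.le
      have hs : 0 < sin x :=
        sin_pos_of_pos_of_lt_pi hx.1 (by linarith [hlt x hx.1.le hx.2.le])
      have hkey := half_mul_cos_mul_sin_le (M := M) (by linarith) hx.1.le
        (by nlinarith [hx.1, hx.2])
      rw [sin_two_mul, cos_two_mul'] at hkey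
      have heq : sin (M * x) / sin x - 1 +
          ((cos x - M * cos (M * x)) * cos x - (sin x - sin (M * x)) * (-sin x)) / cos x ^ 2 =
          (sin (M * x) * (cos x ^ 2 - sin x ^ 2) - M / 2 * cos (M * x) * (2 * sin x * cos x)
            + sin x ^ 3) / (sin x * cos x ^ 2) := by
        field_simp
        ring
      rw [heq]
      refine div_nonneg ?_ (by positivity)
      have : 0 < sin x ^ 3 := by positivity
      linarith
  have h1 := hm (Set.left_mem_Icc.2 h0) (Set.right_mem_Icc.2 h0) h0
  have hG0 : G 0 = 0 := by simp [G, fejerJackson]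
  have hc := hcos h h0 le_rfl
  have h2 : cos h * G h = cos h * fejerJackson n h + (sin h - sin (M * h)) := by
    simp only [G]
    field_simp
  have h3 := mul_nonneg hc.le (hG0 ▸ h1)
  linarith

/-! ### The range `(2n+1)h ≥ π` -/

/-- Integration by parts of `sin (M x) / sin x` gives the boundary term `cos (M x) / (M sin x)`.
Adding `1` to the cosine gives the derivative of `K` a sign; subtracting `sin x` only shifts by a
constant, so that the correction vanishes at `π/2`. -/
lemma le_fejerJackson (n : ℕ) {h : ℝ} (h0 : 0 < h) (hπ : h ≤ π / 2) :
    π / 2 - h - (cos ((2 * n + 1) * h) + 1 - sin h) / ((2 * n + 1) * sin h) ≤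
      fejerJackson n h := by
  set M : ℝ := 2 * n + 1 with hM
  have hM0 : 0 < M := by positivity
  have hpi := pi_pos
  let K : ℝ → ℝ := fun x => fejerJackson n x + x + (cos (M * x) + 1 - sin x) / (M * sin x)
  have hsin : ∀ x, h ≤ x → x ≤ π / 2 → 0 < sin x := fun x h1 h2 =>
    sin_pos_of_pos_of_lt_pi (by linarith) (by linarith)
  have hd : ∀ x, h ≤ x → x ≤ π / 2 → HasDerivAt K (sin (M * x) / sin x - 1 + 1 +
      ((-(M * sin (M * x)) - cos x) * (M * sin x) - (cos (M * x) + 1 - sin x) * (M * cos x)) /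
        (M * sin x) ^ 2) x := fun x h1 h2 =>
    ((hasDerivAt_fejerJackson n (hsin x h1 h2).ne').add (hasDerivAt_id x)).add
      ((((hasDerivAt_cos_const_mul M x).add_const 1).sub (hasDerivAt_sin x)).div
        ((hasDerivAt_sin x).const_mul M) (mul_pos hM0 (hsin x h1 h2)).ne')
  have hm : AntitoneOn K (Set.Icc h (π / 2)) := by
    refine antitoneOn_of_deriv_nonpos (convex_Icc _ _)
      (fun x hx => (hd x hx.1 hx.2).continuousAt.continuousWithinAt) ?_ ?_
    · intro x hx
      rw [interior_Icc] at hx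
      exact (hd x hx.1.le hx.2.le).differentiableAt.differentiableWithinAt
    · intro x hx
      rw [interior_Icc] at hx
      rw [(hd x hx.1.le hx.2.le).deriv]
      have hs := hsin x hx.1.le hx.2.le
      have hc : 0 ≤ cos x := cos_nonneg_of_neg_pi_div_two_le_of_le (by linarith [hx.1]) hx.2.le
      have heq : sin (M * x) / sin x - 1 + 1 +
          ((-(M * sin (M * x)) - cos x) * (M * sin x) - (cos (M * x) + 1 - sin x) * (M * cos x)) /
            (M * sin x) ^ 2 = -((1 + cos (M * x)) * cos x / (M * sin x ^ 2)) := by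
        field_simp
        ring
      rw [heq, neg_nonpos]
      exact div_nonneg (mul_nonneg (by linarith [neg_one_le_cos (M * x)]) hc) (by positivity)
  have h1 := hm (Set.left_mem_Icc.2 hπ) (Set.right_mem_Icc.2 hπ) hπ
  have hF : fejerJackson n (π / 2) = 0 := by
    refine sum_eq_zero fun k _ => ?_
    rw [show 2 * (k : ℝ) * (π / 2) = k * π by ring, sin_nat_mul_pi, zero_div]
  have hC : cos (M * (π / 2)) = 0 := by
    rw [show M * (π / 2) = n * π + π / 2 by rw [hM]; ring, cos_add_pi_div_two, sin_nat_mul_pi,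
      neg_zero]
  simp only [K, hF, hC, sin_pi_div_two] at h1
  norm_num at h1
  linarith

lemma five_halves_le_mul_sin {n : ℕ} (hn : 1 ≤ n) {h : ℝ} (h2 : h ≤ π / 2)
    (hπ : π ≤ (2 * n + 1) * h) : 5 / 2 ≤ (2 * n + 1) * sin h := by
  have hn' : (1 : ℝ) ≤ n := by exact_mod_cast hn
  have hpi := pi_pos
  have h0 : 0 < h := by
    by_contra hh
    push Not at hh
    nlinarith
  have h3 : (5 / 3 : ℝ) ≤ √3 := Real.le_sqrt_of_sq_le (by norm_num)
  rcases le_total h (π / 3) with hle | hle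
  -- On `[0, π/3]` the sine lies above its chord, whose slope `3√3/(2π)` exceeds `5/(2π)`.
  · have hc := strictConcaveOn_sin_Icc.concaveOn.2
      (show (0 : ℝ) ∈ Set.Icc 0 π from ⟨le_rfl, hpi.le⟩)
      (show π / 3 ∈ Set.Icc 0 π from ⟨by positivity, by linarith⟩)
      (show 0 ≤ 1 - 3 * h / π by rw [sub_nonneg, div_le_one hpi]; linarith)
      (show 0 ≤ 3 * h / π by positivity) (by ring)
    simp only [smul_eq_mul, mul_zero, zero_add, sin_zero, sin_pi_div_three] at hc
    rw [show 3 * h / π * (π / 3) = h by field_simp] at hc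
    have h4 : 5 / 2 * (h / π) ≤ sin h := by
      refine le_trans ?_ hc
      have : 0 ≤ h / π := by positivity
      rw [mul_div_assoc]
      nlinarith
    have h5 : 1 ≤ (2 * n + 1) * (h / π) := by
      rw [← mul_div_assoc, le_div_iff₀ hpi]
      linarith
    nlinarith
  · have h4 : √3 / 2 ≤ sin h := by
      rw [← sin_pi_div_three]
      exact sin_le_sin_of_le_of_le_pi_div_two (by linarith) h2 hle
    nlinarith

/-- A lower bound for `u sin u + cos u - 1` on `[0, π/2]`, written with `u = π/2 - h`. -/
lemma le_mul_cos_add_sin {h : ℝ} (h0 : 0 < h) (h2 : h < π / 2) :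
    2 / 25 * cos h ^ 2 + 2 / 5 * (cos h * (1 - sin h)) ≤ (π / 2 - h) * cos h + sin h - 1 := by
  have hp : 0 < cos h := cos_pos_of_mem_Ioo ⟨by linarith, h2⟩
  have hq : 0 < sin h := sin_pos_of_pos_of_lt_pi h0 (by linarith)
  have hq1 := sin_le_one h
  have hsq := sin_sq_add_cos_sq h
  rcases le_total (sin h) (1 / 2) with hle | hle
  -- Since `h cos h ≤ sin h`, the right side is at least `1.57 p - 1`; as `p² ≤ p`, it remains to
  -- show `p (1.17 + 2q/5) ≥ 1.08`.
  · have htan : h * cos h ≤ sin h := by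
      have := (Real.lt_tan h0 h2).le
      rwa [tan_eq_sin_div_cos, le_div_iff₀ hp] at this
    have hpi : 1.57 * cos h ≤ π / 2 * cos h := by
      have := pi_gt_d2
      gcongr
      linarith
    generalize sin h = q at *
    generalize cos h = p at *
    have hp1 : 1 - 3 / 5 * q ^ 2 ≤ p := by
      apply le_of_sq_le_sq _ hp.le
      nlinarith [mul_nonneg (sq_nonneg q) (show 0 ≤ 1 / 4 - q ^ 2 by nlinarith)]
    have h3 : (1 - 3 / 5 * q ^ 2) * (1.17 + 2 / 5 * q) ≤ p * (1.17 + 2 / 5 * q) := by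
      gcongr
    have h4 : 1.08 ≤ (1 - 3 / 5 * q ^ 2) * (1.17 + 2 / 5 * q) := by
      nlinarith [mul_nonneg hq.le (show 0 ≤ 1 / 2 - q by linarith),
        mul_nonneg (mul_nonneg hq.le hq.le) (show 0 ≤ 1 / 2 - q by linarith)]
    nlinarith
  -- Now the right side is at least `p² + q - 1 = q (1 - q)`, and `1 - q` factors out of both sides.
  · have hu : cos h ≤ π / 2 - h := by
      rw [← sin_pi_div_two_sub]
      exact sin_le (by linarith)
    have h3 := mul_le_mul_of_nonneg_right hu hp.le
    generalize sin h = q at *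
    generalize cos h = p at *
    have hp1 : p ≤ 9 / 10 := by nlinarith
    nlinarith [mul_nonneg (show 0 ≤ 1 - q by linarith)
      (show 0 ≤ q - 2 / 25 * (1 + q) - 2 / 5 * p by linarith)]

lemma le_cos_mul_fejerJackson_add {n : ℕ} (hn : 1 ≤ n) {h s : ℝ} (h2 : h < π / 2)
    (hπ : π ≤ (2 * n + 1) * h) (hs : s ^ 2 + cos ((2 * n + 1) * h) ^ 2 = 1) :
    s ≤ cos h * fejerJackson n h + sin h := by
  have hpi := pi_pos
  have h0 : 0 < h := by
    by_contra hh
    push Not at hh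
    nlinarith [n.cast_nonneg (α := ℝ)]
  have hp : 0 < cos h := cos_pos_of_mem_Ioo ⟨by linarith, h2⟩
  have hq : 0 < sin h := sin_pos_of_pos_of_lt_pi h0 (by linarith)
  have hF := mul_le_mul_of_nonneg_left (le_fejerJackson n h0 h2.le) hp.le
  have hQ := five_halves_le_mul_sin hn h2.le hπ
  have hI := le_mul_cos_add_sin h0 h2
  have hq1 := sin_le_one h
  set c := cos ((2 * n + 1) * h)
  set z := ((2 * n + 1) * sin h)⁻¹ with hz
  have hz0 : 0 ≤ z := by positivity
  have hz1 : z ≤ 2 / 5 := by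
    rw [hz]
    exact inv_le_of_inv_le₀ (by norm_num) (by norm_num; linarith)
  rw [div_eq_mul_inv _ ((2 * n + 1) * sin h), ← hz] at hF
  -- From `2s ≤ 1 + s²`; only `s²` enters, so the sign `(-1)^n` is irrelevant.
  have hs1 : s ≤ 1 - c ^ 2 / 2 := by nlinarith [sq_nonneg (s - 1)]
  have h3 : cos h * (1 - sin h) * z ≤ cos h * (1 - sin h) * (2 / 5) :=
    mul_le_mul_of_nonneg_left hz1 (mul_nonneg hp.le (by linarith))
  have h4 : cos h ^ 2 * z ^ 2 ≤ cos h ^ 2 * (4 / 25) := by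
    gcongr
    nlinarith
  -- Completing the square in `c` leaves exactly `hI`, once `z` is replaced by `2/5`.
  nlinarith [sq_nonneg (c - cos h * z)]

/-! ### Nonnegativity -/

lemma isPSum_delta : IsPSum delta (Set.Icc 0 π) := by
  intro n hn x hx
  rcases hx.1.eq_or_lt with rfl | hx0
  · simp [partialSum]
  obtain ⟨h, rfl⟩ : ∃ h, x = π - 2 * h := ⟨(π - x) / 2, by ring⟩
  have h0 : 0 ≤ h := by linarith [hx.2]
  have h2 : h < π / 2 := by linarith
  have hp : 0 < cos h := cos_pos_of_mem_Ioo ⟨by linarith [pi_pos], h2⟩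
  refine nonneg_of_mul_nonneg_right ?_ hp
  rw [cos_mul_partialSum_delta, sub_nonneg]
  rcases le_total ((2 * n + 1) * h) π with hπ | hπ
  · rcases n.even_or_odd with he | ho
    · rw [he.neg_one_pow, one_mul]
      exact sin_le_cos_mul_fejerJackson_add hn h0 hπ
    · rw [ho.neg_one_pow, neg_one_mul]
      have h3 := sin_nonneg_of_nonneg_of_le_pi (by positivity) hπ
      have h4 := sin_nonneg_of_nonneg_of_le_pi h0 (by linarith [pi_pos])
      have h5 := mul_nonneg hp.le (fejerJackson_nonneg_of_le h0 hπ)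
      linarith
  · refine le_cos_mul_fejerJackson_add hn h2 hπ ?_
    rw [mul_pow, ← pow_mul, mul_comm n 2, pow_mul]
    simp

lemma Admissible.isPSum {a : ℕ → ℝ} (ha : Admissible a) : IsPSum a (Set.Icc 0 π) := by
  intro n hn x hx
  have hS : ∀ n, 1 ≤ n → 0 ≤ partialSum delta n x := fun n hn => isPSum_delta n hn x hx
  exact (mul_nonneg (div_nonneg (ha.nonneg n hn) (delta_pos hn).le) (hS n hn)).trans
    (ratio_mul_partialSum_le (fun _ => delta_pos) (fun _ => ha.ratio_succ_le) hS hn)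

end SineSums

theorem theorem2 :
    (∀ a : ℕ → ℝ, SineSums.Admissible a → SineSums.IsPSum a (Set.Icc 0 Real.pi)) ∧
    SineSums.IsMaximalAdmissible SineSums.delta ∧
    (∀ e : ℕ → ℝ, SineSums.IsMaximalAdmissible e →
      ∃ c : ℝ, 0 < c ∧ ∀ k : ℕ, 1 ≤ k → e k = c * SineSums.delta k) :=
  ⟨fun _ ha => ha.isPSum, SineSums.isMaximalAdmissible_delta,
    fun _ he => he.eq_const_mul_delta⟩
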